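/- Let $\mathcal H$ be a finite-dimensional complex Hilbert space, $\mathcal X$ an arbitrary input alphabet, and $x\mapsto W_x$ a classical-quantum channel, i.e. $W_x$ is a density operator (positive semidefinite, unit trace) on $\mathcal H$ for every $x\in\mathcal X$. Let $\mathcal C=(x_1,\dots,x_M)$, $M\ge 1$, be a codebook of size $M$ with codewords in $\mathcal X$, and let $$P_e(\mathcal C)=\min_{\{\Pi_1,\dots,\Pi_M\}}\Bigl\{1-\frac1M\sum_{m=1}^M\operatorname{tr}(W_{x_m}\Pi_m)\Bigr\}$$ be its minimum average error probability, where the minimum is over all POVMs ($\Pi_m\ge 0$, $\sum_m\Pi_m=\mathbb 1$) on $\mathcal H$. For a (discrete) probability distribution $P$ on $\mathcal X$ and a density operator $\mu$ on $\mathcal H$ put $$PW=\sum_{x\in\mathcal X}P(x)\,|x\rangle\langle x|\otimes W_x,\qquad P\otimes\mu=\Bigl(\sum_{x\in\mathcal X}P(x)\,|x\rangle\langle x|\Bigr)\otimes\mu ,$$ operators on $\ell^2(\mathcal X)\otimes\mathcal H$, and let $P_{\mathcal C}$ be the distribution on $\mathcal X$ induced by the codebook, $P_{\mathcal C}(x)=\frac1M\,|\{m: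 x_m=x\}|$. For density operators $\rho_0,\rho_1$ on the same space and $\beta\ge 0$ let $$\alpha_\beta(\rho_0\|\rho_1)=\inf\bigl\{1-\operatorname{tr}(\rho_0T)\;:\;0\le T\le\mathbb 1,\ \operatorname{tr}(\rho_1T)\le\beta\bigr\}.$$ Then the minimum defining $P_e(\mathcal C)$ is attained, and $$P_e(\mathcal C)=\sup_{\mu}\ \alpha_{1/M}\bigl(P_{\mathcal C}W\,\|\,P_{\mathcal C}\otimes\mu\bigr)\ \ge\ \inf_P\,\sup_{\mu}\ \alpha_{1/M}\bigl(PW\,\|\,P\otimes\mu\bigr),$$ where the suprema are over all density operators $\mu$ on $\mathcal H$ and the infimum is over all probability distributions $P$ on $\mathcal X$. -/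

import Mathlib

open scoped Kronecker ComplexOrder

/-! Operators on the Hilbert space `ℓ²(ι)` are given by their matrices in the standard orthonormal
basis. The index set `ι` may be infinite: `Matrix.PosSemidef` then tests against finitely supported
vectors, so the matrices `T` with `0 ≤ T ≤ 1` are exactly the matrices of the bounded operators on
`ℓ²(ι)` between `0` and the identity. The finite-dimensional output space `ℋ` of a channel is `ℂⁿ`
for a finite index set `n`. -/

namespace CQ

/-- A density matrix on the finite-dimensional space `ℂⁿ`. -/
def IsDensityMatrix {n : Type*} [Fintype n] (ρ : Matrix n n ℂ) : Prop :=
  ρ.PosSemidef ∧ ρ.trace = 1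

/-- The set of density matrices, as a type. -/
abbrev DensityMatrix (n : Type*) [Fintype n] : Type _ :=
  {ρ : Matrix n n ℂ // IsDensityMatrix ρ}

/-- `tr (A B) = ∑ₐ ⟨eₐ, A B eₐ⟩`, for a trace class operator `A` and a bounded operator `B`. -/
noncomputable def trMul {ι : Type*} (A B : Matrix ι ι ℂ) : ℂ :=
  ∑' a, ∑' b, A a b * B b a

theorem trMul_eq_trace {ι : Type*} [Fintype ι] (A B : Matrix ι ι ℂ) :
    trMul A B = (A * B).trace := by
  simp [trMul, Matrix.trace, Matrix.mul_apply]

section BinaryTest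

variable {ι : Type*} [DecidableEq ι]

/-- The operator `T` of a binary test `{T, 1 - T}`; `T` is the decision for the first state. -/
def IsTest (T : Matrix ι ι ℂ) : Prop :=
  T.PosSemidef ∧ (1 - T).PosSemidef

/-- Probability `1 - tr (ρ₀ T)` of deciding `ρ₁` when the state is `ρ₀`. -/
noncomputable def typeIError (ρ₀ T : Matrix ι ι ℂ) : ℝ :=
  1 - (trMul ρ₀ T).re

/-- Probability `tr (ρ₁ T)` of deciding `ρ₀` when the state is `ρ₁`. -/
noncomputable def typeIIError (ρ₁ T : Matrix ι ι ℂ) : ℝ :=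
  (trMul ρ₁ T).re

/-- `α_β(ρ₀ ‖ ρ₁)`: the infimum of the first error over all tests whose second error is at
most `β`. -/
noncomputable def alpha (β : ℝ) (ρ₀ ρ₁ : Matrix ι ι ℂ) : ℝ :=
  sInf (typeIError ρ₀ '' {T | IsTest T ∧ typeIIError ρ₁ T ≤ β})

end BinaryTest

section Channel

variable {X n : Type*} [DecidableEq X]

/-- `P W = ∑ₓ P(x) |x⟩⟨x| ⊗ Wₓ`, as a block diagonal matrix. -/
noncomputable def cqState (P : PMF X) (W : X → Matrix n n ℂ) : Matrix (X × n) (X × n) ℂ :=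
  Matrix.of fun a b => if a.1 = b.1 then ((P a.1).toReal : ℂ) * W a.1 a.2 b.2 else 0

theorem cqState_eq_sum [Fintype X] (P : PMF X) (W : X → Matrix n n ℂ) :
    cqState P W = ∑ x, ((P x).toReal : ℂ) • (Matrix.single x x (1 : ℂ) ⊗ₖ W x) := by
  ext ⟨x, i⟩ ⟨y, j⟩
  simp only [cqState, Matrix.of_apply, Matrix.sum_apply, Matrix.smul_apply,
    Matrix.kroneckerMap_apply, Matrix.single_apply, smul_eq_mul]
  by_cases h : x = y
  · subst h
    simp
  · rw [if_neg h, Finset.sum_eq_zero]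
    intro z _
    rw [if_neg (fun hz => h (hz.1.symm.trans hz.2))]
    simp

/-- `P ⊗ μ = (∑ₓ P(x) |x⟩⟨x|) ⊗ μ`. -/
noncomputable def prodState (P : PMF X) (μ : Matrix n n ℂ) : Matrix (X × n) (X × n) ℂ :=
  Matrix.diagonal (fun x => ((P x).toReal : ℂ)) ⊗ₖ μ

end Channel

section Code

variable {X n : Type*} [Fintype n] [DecidableEq n] {M : ℕ}

/-- A positive operator-valued measure with outcomes in `Fin M`. -/
def IsPOVM (D : Fin M → Matrix n n ℂ) : Prop :=
  (∀ m, (D m).PosSemidef) ∧ ∑ m, D m = 1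

/-- Average error probability of the codewords `c` with decoder `D`, for equiprobable messages. -/
noncomputable def codeError (W : X → Matrix n n ℂ) (c : Fin M → X) (D : Fin M → Matrix n n ℂ) :
    ℝ :=
  1 - 1 / (M : ℝ) * ∑ m, ((W (c m) * D m).trace).re

/-- The minimum error probability of the code `c` over all decoders. -/
noncomputable def Pe (W : X → Matrix n n ℂ) (c : Fin M → X) : ℝ :=
  sInf (codeError W c '' {D | IsPOVM D})

/-- The input distribution induced by a code: the law of the codeword of a uniformly random
message. -/
noncomputable def codeDist [NeZero M] (c : Fin M → X) : PMF X :=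
  (PMF.uniformOfFintype (Fin M)).map c

end Code

end CQ

/-! The minimum error is attained because the decoders form a compact set (`isCompact_isPOVM`) on
which the error is continuous.

A decoder `D` becomes a test between `P_𝒞 W` and `P_𝒞 ⊗ μ` by testing, for each input `x`, with the
average of the `D m` over the messages `m` encoded as `x`. The first error of this test is the error
of the decoder and its second error is `1 / M`, for every `μ` (`exists_isTest_of_isPOVM`). Hence
`α_{1/M}(P_𝒞 W ‖ P_𝒞 ⊗ μ) ≤ Pe` for every `μ`.

The supremum is attained by a `μ` that comes from semidefinite duality. If `D` is optimal, let `K` be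
the Hermitian part of `∑ W (c m) * D m`, so that `tr K = M (1 - Pe)`. Compressing every `D m` with
`1 - ε v v*` and giving the lost mass to the outcome `j` is a feasible variation, and its first order
term in `ε` shows `W (c j) ≤ K` (`posSemidef_sub_of_optimal`). Take `μ = K / tr K`. A test with
blocks `T (c m)` and second error at most `1 / M` satisfies
`∑ tr (W (c m) T (c m)) ≤ ∑ tr (K T (c m)) = tr K * ∑ tr (μ T (c m)) ≤ tr K`,
so its first error is at least `1 - tr K / M = Pe` (`exists_Pe_le_alpha`).

For the infimum over all `P` it remains to know that it is over a set bounded below: first errors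
on classical-quantum states are nonnegative, also when the support of `P` is infinite
(`typeIError_cqState_nonneg`). -/

namespace CQ

/-! ### Positive semidefinite matrices -/

section PositiveMatrices

variable {n : Type*} [Fintype n]

open scoped MatrixOrder Matrix.Norms.L2Operator in
theorem trace_mul_nonneg [DecidableEq n] {A B : Matrix n n ℂ} (hA : A.PosSemidef)
    (hB : B.PosSemidef) : 0 ≤ (A * B).trace := by
  obtain ⟨C, rfl⟩ := CStarAlgebra.nonneg_iff_eq_star_mul_self.mp hA.nonneg
  rw [Matrix.mul_assoc, Matrix.trace_mul_comm]
  exact (hB.mul_mul_conjTranspose_same C).trace_nonneg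

theorem trace_mul_mono [DecidableEq n] {A B T : Matrix n n ℂ} (hAB : (B - A).PosSemidef)
    (hT : T.PosSemidef) : (A * T).trace ≤ (B * T).trace := by
  have h := trace_mul_nonneg hAB hT
  rwa [Matrix.sub_mul, Matrix.trace_sub, sub_nonneg] at h

theorem trace_mul_le_trace [DecidableEq n] {A T : Matrix n n ℂ} (hA : A.PosSemidef)
    (hT : (1 - T).PosSemidef) : (A * T).trace ≤ A.trace := by
  have h := trace_mul_nonneg hA hT
  rwa [Matrix.mul_sub, Matrix.mul_one, Matrix.trace_sub, sub_nonneg] at h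

omit [Fintype n] in
/-- The `2 × 2` minor on the indices `i, j` gives `|A i j|² ≤ A i i * A j j ≤ 1`. -/
theorem norm_entry_le_one [DecidableEq n] {A : Matrix n n ℂ} (hA : A.PosSemidef)
    (hA' : (1 - A).PosSemidef) (i j : n) : ‖A i j‖ ≤ 1 := by
  have hdet := (hA.submatrix ![i, j]).det_nonneg
  rw [Matrix.det_fin_two] at hdet
  have hii := hA'.diag_nonneg (i := i)
  have hjj := hA'.diag_nonneg (i := j)
  have hjj0 := hA.diag_nonneg (i := j)
  have hsymm : A j i = star (A i j) := (hA.isHermitian.apply j i).symm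
  simp only [Matrix.submatrix_apply, Matrix.cons_val_zero, Matrix.cons_val_one,
    Matrix.sub_apply, Matrix.one_apply_eq, sub_nonneg, hsymm, Complex.star_def,
    Complex.mul_conj, Complex.normSq_eq_norm_sq] at hdet hii hjj
  have h : ((‖A i j‖ ^ 2 : ℝ) : ℂ) ≤ ((1 : ℝ) : ℂ) :=
    hdet.trans ((mul_le_mul hii hjj hjj0 zero_le_one).trans (by simp))
  have h' : ‖A i j‖ ^ 2 ≤ 1 := Complex.real_le_real.mp h
  exact (sq_le_one_iff₀ (norm_nonneg _)).mp h'

theorem isClosed_posSemidef : IsClosed {A : Matrix n n ℂ | A.PosSemidef} := by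
  simp only [Matrix.posSemidef_iff_dotProduct_mulVec, Set.ofPred_and, Set.ofPred_forall]
  refine IsClosed.inter (isClosed_eq ?_ continuous_id) (isClosed_iInter fun v => ?_)
  · fun_prop
  · exact isClosed_le continuous_const (by fun_prop)

theorem trace_mul_vecMulVec (A : Matrix n n ℂ) (v : n → ℂ) :
    (A * Matrix.vecMulVec v (star v)).trace = star v ⬝ᵥ A.mulVec v := by
  rw [Matrix.mul_vecMulVec, Matrix.trace_vecMulVec, dotProduct_comm]

theorem posSemidef_of_trace_mul_vecMulVec {A : Matrix n n ℂ} (hA : A.IsHermitian)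
    (h : ∀ v, 0 ≤ (A * Matrix.vecMulVec v (star v)).trace.re) : A.PosSemidef := by
  refine .of_dotProduct_mulVec_nonneg hA fun v => ?_
  rw [Complex.nonneg_iff]
  refine ⟨by simpa [trace_mul_vecMulVec] using h v, ?_⟩
  exact (hA.im_star_dotProduct_mulVec_self v).symm

/-- The set `X` of blocks may be infinite: a finitely supported vector meets only finitely many
blocks. -/
theorem posSemidef_blockDiagonal {X : Type*} [DecidableEq X] {T : X → Matrix n n ℂ}
    (hT : ∀ x, (T x).PosSemidef) : (Matrix.blockDiagonal T).PosSemidef := by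
  classical
  refine ⟨?_, fun v => ?_⟩
  · rw [Matrix.IsHermitian, Matrix.blockDiagonal_conjTranspose]
    exact congrArg _ (funext fun x => (hT x).isHermitian)
  · set S : Finset X := v.support.image Prod.snd
    have hS : v.support ⊆ Finset.univ ×ˢ S := fun a ha => by
      simpa [S] using ⟨a.1, by simpa using ha⟩
    have hsum : (v.sum fun a va => v.sum fun b vb =>
          star va * Matrix.blockDiagonal T a b * vb) =
        ∑ x ∈ S, star (fun i => v (i, x)) ⬝ᵥ (T x).mulVec (fun i => v (i, x)) := by
      rw [Finsupp.sum_of_support_subset _ hS _ (by simp)]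
      rw [Finset.sum_product_right]
      refine Finset.sum_congr rfl fun x hx => ?_
      refine Finset.sum_congr rfl fun i _ => ?_
      rw [Finsupp.sum_of_support_subset _ hS _ (by simp), Finset.sum_product_right,
        Finset.sum_eq_single x, Matrix.mulVec, dotProduct, Finset.mul_sum]
      · simp [Matrix.blockDiagonal_apply, mul_assoc]
      · intro y _ hy
        simp [Matrix.blockDiagonal_apply, hy.symm]
      · exact fun h => (h hx).elim
    rw [hsum]
    exact Finset.sum_nonneg fun x _ => (hT x).dotProduct_mulVec_nonneg _

end PositiveMatrices

/-! ### Compactness of the set of decoders -/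

section Decoders

variable {X n : Type*} [Fintype n] [DecidableEq n] {M : ℕ}

omit [Fintype n] in
theorem IsPOVM.posSemidef_one_sub_sum {D : Fin M → Matrix n n ℂ} (hD : IsPOVM D)
    (s : Finset (Fin M)) : (1 - ∑ m ∈ s, D m).PosSemidef := by
  rw [← hD.2, ← Finset.sum_add_sum_compl s D, add_sub_cancel_left]
  exact Matrix.posSemidef_sum _ fun m _ => hD.1 m

omit [Fintype n] in
theorem exists_isPOVM [NeZero M] : ∃ D : Fin M → Matrix n n ℂ, IsPOVM D := by
  refine ⟨Pi.single 0 1, fun m => ?_, by simp⟩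
  rcases eq_or_ne m 0 with rfl | hm
  · simpa using Matrix.PosSemidef.one
  · simpa [hm] using Matrix.PosSemidef.zero

omit [Fintype n] in
theorem IsPOVM.posSemidef_one_sub {D : Fin M → Matrix n n ℂ} (hD : IsPOVM D) (m : Fin M) :
    (1 - D m).PosSemidef := by
  simpa using hD.posSemidef_one_sub_sum {m}

theorem isCompact_isPOVM : IsCompact {D : Fin M → Matrix n n ℂ | IsPOVM D} := by
  have hbox : IsCompact (Set.pi Set.univ fun _ : Fin M => Set.pi Set.univ fun _ : n =>
      Set.pi Set.univ fun _ : n => Metric.closedBall (0 : ℂ) 1) :=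
    isCompact_univ_pi fun _ => isCompact_univ_pi fun _ => isCompact_univ_pi fun _ =>
      isCompact_closedBall _ _
  refine hbox.of_isClosed_subset ?_ fun D hD m _ i _ j _ => ?_
  · refine IsClosed.inter (s₁ := {D : Fin M → Matrix n n ℂ | ∀ m, (D m).PosSemidef})
      (s₂ := {D | ∑ m, D m = 1}) ?_ ?_
    · simp only [Set.ofPred_forall]
      exact isClosed_iInter fun m => isClosed_posSemidef.preimage
        (continuous_apply m : Continuous fun D : Fin M → Matrix n n ℂ => D m)
    · exact isClosed_eq (by fun_prop) continuous_const
  · rw [mem_closedBall_zero_iff]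
    refine norm_entry_le_one (hD.1 m) ?_ i j
    exact IsPOVM.posSemidef_one_sub hD m

/-- An optimal decoder exists. -/
theorem isLeast_Pe [NeZero M] (W : X → Matrix n n ℂ) (c : Fin M → X) :
    IsLeast (codeError W c '' {D | IsPOVM D}) (Pe W c) := by
  have hcont : Continuous (codeError W c) := by
    unfold codeError
    refine continuous_const.sub (continuous_const.mul (continuous_finsetSum _ fun m _ =>
      Complex.continuous_re.comp ?_))
    exact (continuous_const.matrix_mul (continuous_apply m)).matrix_trace
  obtain ⟨D, hD⟩ := exists_isPOVM (n := n) (M := M)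
  exact (isCompact_isPOVM.image hcont).isLeast_sInf ⟨_, D, hD, rfl⟩

end Decoders

/-! ### Optimality conditions for decoders -/

section Optimality

variable {n : Type*} [Fintype n] [DecidableEq n] {M : ℕ}

/-- The decoder obtained from `D` by compressing each `D m` with `1 - ε P`, for a Hermitian `P`, and
handing the lost mass `1 - (1 - ε P)²` to the outcome `j`. -/
noncomputable def perturbPOVM (D : Fin M → Matrix n n ℂ) (j : Fin M) (P : Matrix n n ℂ) (ε : ℝ) :
    Fin M → Matrix n n ℂ :=
  fun m => (1 - (ε : ℂ) • P) * D m * (1 - (ε : ℂ) • P) +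
    if m = j then 1 - (1 - (ε : ℂ) • P) * (1 - (ε : ℂ) • P) else 0

/-- The bound on `ε` makes the lost mass `1 - (1 - ε P)² = ε (2 - ε ‖v‖²) P` positive
semidefinite. -/
theorem isPOVM_perturbPOVM {D : Fin M → Matrix n n ℂ} (hD : IsPOVM D) (j : Fin M) (v : n → ℂ)
    {ε : ℝ} (hε : 0 ≤ ε) (hε' : ε * (star v ⬝ᵥ v).re ≤ 2) :
    IsPOVM (perturbPOVM D j (Matrix.vecMulVec v (star v)) ε) := by
  set P := Matrix.vecMulVec v (star v) with hP
  have hPpos : P.PosSemidef := Matrix.posSemidef_vecMulVec_self_star v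
  have hs : star v ⬝ᵥ v = (((star v ⬝ᵥ v).re : ℝ) : ℂ) :=
    Complex.eq_re_of_ofReal_le (r := 0) (by simp)
  have hA : (1 - (ε : ℂ) • P).IsHermitian := by
    simp [Matrix.IsHermitian, hPpos.isHermitian.eq]
  have hlost : (1 - (1 - (ε : ℂ) • P) * (1 - (ε : ℂ) • P)).PosSemidef := by
    have hPP : P * P = (((star v ⬝ᵥ v).re : ℝ) : ℂ) • P := by
      rw [← hs, hP, Matrix.vecMulVec_mul_vecMulVec, Matrix.vecMulVec_smul]
    have h : 1 - (1 - (ε : ℂ) • P) * (1 - (ε : ℂ) • P) =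
        ((ε * (2 - ε * (star v ⬝ᵥ v).re) : ℝ) : ℂ) • P := by
      simp only [Matrix.mul_sub, Matrix.sub_mul, Matrix.one_mul, Matrix.mul_one,
        Matrix.smul_mul, Matrix.mul_smul, hPP, smul_smul]
      push_cast
      module
    rw [h]
    refine hPpos.smul ?_
    exact Complex.zero_le_real.mpr (mul_nonneg hε (by linarith))
  refine ⟨fun m => ?_, ?_⟩
  · refine Matrix.PosSemidef.add ?_ ?_
    · have h := (hD.1 m).mul_mul_conjTranspose_same (1 - (ε : ℂ) • P)
      rwa [hA.eq] at h
    · split_ifs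
      · exact hlost
      · exact .zero
  · simp only [perturbPOVM, Finset.sum_add_distrib, ← Finset.sum_mul, ← Finset.mul_sum, hD.2]
    simp

/-- The objective along the perturbation is a quadratic polynomial in `ε`. -/
theorem sum_trace_perturbPOVM (W D : Fin M → Matrix n n ℂ) (j : Fin M) (P : Matrix n n ℂ)
    (ε : ℝ) :
    ∑ m, (W m * perturbPOVM D j P ε m).trace = ∑ m, (W m * D m).trace -
      ε * ((∑ m, (W m * D m + D m * W m) - (2 : ℂ) • W j) * P).trace +
      ε ^ 2 * (∑ m, (W m * P * D m * P).trace - (W j * P * P).trace) := by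
  have hterm : ∀ m, (W m * ((1 - (ε : ℂ) • P) * D m * (1 - (ε : ℂ) • P))).trace =
      (W m * D m).trace - ε * ((W m * D m + D m * W m) * P).trace +
        ε ^ 2 * (W m * P * D m * P).trace := by
    intro m
    have h1 : (W m * (P * D m)).trace = (D m * (W m * P)).trace := by
      rw [← Matrix.mul_assoc, Matrix.trace_mul_comm]
    simp only [Matrix.mul_sub, Matrix.sub_mul, Matrix.one_mul, Matrix.mul_one,
      Matrix.smul_mul, Matrix.mul_smul, Matrix.trace_sub, Matrix.trace_smul, Matrix.add_mul,
      Matrix.trace_add, smul_eq_mul, Matrix.mul_assoc, h1]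
    ring
  have hj : (W j * (1 - (1 - (ε : ℂ) • P) * (1 - (ε : ℂ) • P))).trace =
      2 * ε * (W j * P).trace - ε ^ 2 * (W j * P * P).trace := by
    simp only [Matrix.mul_sub, Matrix.sub_mul, Matrix.one_mul, Matrix.mul_one,
      Matrix.smul_mul, Matrix.mul_smul, Matrix.trace_sub, Matrix.trace_smul,
      smul_eq_mul, Matrix.mul_assoc]
    ring
  have hsplit : ∑ m, (W m * perturbPOVM D j P ε m).trace =
      ∑ m, (W m * ((1 - (ε : ℂ) • P) * D m * (1 - (ε : ℂ) • P))).trace +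
        (W j * (1 - (1 - (ε : ℂ) • P) * (1 - (ε : ℂ) • P))).trace := by
    simp [perturbPOVM, Matrix.mul_add, Finset.sum_add_distrib, mul_ite, apply_ite Matrix.trace]
  rw [hsplit, hj, Finset.sum_congr rfl fun m _ => hterm m, Matrix.sub_mul, Matrix.trace_sub,
    Matrix.sum_mul, Matrix.trace_sum, Matrix.smul_mul, Matrix.trace_smul, smul_eq_mul,
    Finset.sum_add_distrib, Finset.sum_sub_distrib, ← Finset.mul_sum, ← Finset.mul_sum]
  ring

/-- The Holevo–Yuen–Kennedy–Lax condition: if `D` maximizes `∑ tr (Wₘ Dₘ)` over all decoders, then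
`Wⱼ` is at most the Hermitian part of `∑ Wₘ Dₘ`, here multiplied by `2`. The derivative at `ε = 0`
of the objective along `perturbPOVM D j (v v*) ε` is minus the quadratic form of the difference
at `v`. -/
theorem posSemidef_sub_of_optimal {W D : Fin M → Matrix n n ℂ} (hW : ∀ m, (W m).IsHermitian)
    (hD : IsPOVM D)
    (hopt : ∀ D' : Fin M → Matrix n n ℂ, IsPOVM D' →
      ∑ m, (W m * D' m).trace.re ≤ ∑ m, (W m * D m).trace.re) (j : Fin M) :
    (∑ m, (W m * D m + D m * W m) - (2 : ℂ) • W j).PosSemidef := by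
  refine posSemidef_of_trace_mul_vecMulVec ?_ fun v => ?_
  · refine Matrix.IsHermitian.sub ?_ ?_
    · rw [Matrix.IsHermitian, Matrix.conjTranspose_sum]
      refine Finset.sum_congr rfl fun m _ => ?_
      rw [Matrix.conjTranspose_add, Matrix.conjTranspose_mul, Matrix.conjTranspose_mul,
        (hW m).eq, (hD.1 m).isHermitian.eq, add_comm]
    · simp [Matrix.IsHermitian, (hW j).eq]
  · set P := Matrix.vecMulVec v (star v)
    set a := ((∑ m, (W m * D m + D m * W m) - (2 : ℂ) • W j) * P).trace.re
    set b := (∑ m, (W m * P * D m * P).trace - (W j * P * P).trace).re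
    set s := (star v ⬝ᵥ v).re
    have hs : 0 ≤ s := (Complex.nonneg_iff.mp (dotProduct_star_self_nonneg v)).1
    have hle : ∀ ε : ℝ, 0 < ε → ε * s ≤ 2 → ε * b ≤ a := by
      intro ε hε hε'
      have h := hopt _ (isPOVM_perturbPOVM hD j v hε.le hε')
      rw [← Complex.re_sum, ← Complex.re_sum, sum_trace_perturbPOVM] at h
      rw [Complex.add_re, Complex.sub_re, Complex.re_ofReal_mul, ← Complex.ofReal_pow,
        Complex.re_ofReal_mul] at h
      change _ - ε * a + ε ^ 2 * b ≤ _ at h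
      have h' : ε * (ε * b) ≤ ε * a := by linarith
      exact le_of_mul_le_mul_left h' hε
    -- Let `ε → 0`.
    have hlim : Filter.Tendsto (fun ε : ℝ => ε * b) (nhdsWithin 0 (Set.Ioi 0)) (nhds 0) := by
      have h : Continuous fun ε : ℝ => ε * b := by fun_prop
      simpa using (h.tendsto 0).mono_left nhdsWithin_le_nhds
    refine le_of_tendsto hlim ?_
    have hpos : (0 : ℝ) < 2 / (s + 1) := by positivity
    filter_upwards [Ioo_mem_nhdsGT hpos] with ε hε
    refine hle ε hε.1 ?_
    have h := (lt_div_iff₀ (by positivity)).mp hε.2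
    nlinarith [hε.1]

/-- Strong duality: the maximum of `∑ tr (Wₘ Dₘ)` over all decoders is the trace of some `K` that
dominates every `Wₘ`. -/
theorem exists_trace_eq_of_optimal {W D : Fin M → Matrix n n ℂ} (hW : ∀ m, (W m).IsHermitian)
    (hD : IsPOVM D)
    (hopt : ∀ D' : Fin M → Matrix n n ℂ, IsPOVM D' →
      ∑ m, (W m * D' m).trace.re ≤ ∑ m, (W m * D m).trace.re) :
    ∃ K : Matrix n n ℂ, (∀ m, (K - W m).PosSemidef) ∧
      K.trace.re = ∑ m, (W m * D m).trace.re := by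
  refine ⟨(1 / 2 : ℝ) • ∑ m, (W m * D m + D m * W m), fun j => ?_, ?_⟩
  · have h := (posSemidef_sub_of_optimal hW hD hopt j).smul (a := (1 / 2 : ℝ)) (by norm_num)
    convert h using 1
    rw [smul_sub, ← Complex.coe_smul, ← Complex.coe_smul, smul_smul]
    norm_num
  · rw [Matrix.trace_smul, Matrix.trace_sum, Complex.smul_re, Complex.re_sum, Finset.smul_sum]
    refine Finset.sum_congr rfl fun m _ => ?_
    rw [Matrix.trace_add, Matrix.trace_mul_comm (D m), Complex.add_re, smul_eq_mul]
    ring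

end Optimality

/-! ### Tests on classical-quantum states -/

section States

variable {X n : Type*} [DecidableEq X]

theorem prodState_eq_cqState (P : PMF X) (μ : Matrix n n ℂ) :
    prodState P μ = cqState P fun _ => μ := by
  ext a b
  by_cases h : a.1 = b.1 <;> simp [prodState, cqState, h]

variable [Fintype n]

/-- The block `T_{xx} = (⟨x| ⊗ 1) T (|x⟩ ⊗ 1)` of an operator on `ℓ²(X) ⊗ ℂⁿ`. -/
def block (T : Matrix (X × n) (X × n) ℂ) (x : X) : Matrix n n ℂ :=
  T.submatrix (Prod.mk x) (Prod.mk x)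

/-- Only the diagonal blocks of a test matter on a classical-quantum state. -/
theorem trMul_cqState (P : PMF X) (W : X → Matrix n n ℂ) (T : Matrix (X × n) (X × n) ℂ) :
    trMul (cqState P W) T =
      ∑' a : X × n, ((P a.1).toReal : ℂ) * (W a.1 * block T a.1) a.2 a.2 := by
  refine tsum_congr fun ⟨x, i⟩ => ?_
  have hsupp : ∀ b ∉ (Finset.univ : Finset n).map ⟨Prod.mk x, Prod.mk_right_injective x⟩,
      cqState P W (x, i) b * T b (x, i) = 0 := by
    rintro ⟨y, j⟩ hb
    have hxy : x ≠ y := fun h => hb (by simp [h])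
    simp [cqState, hxy]
  rw [tsum_eq_sum hsupp, Finset.sum_map, Matrix.mul_apply, Finset.mul_sum]
  simp [cqState, block, mul_assoc]

theorem codeDist_toReal {M : ℕ} [NeZero M] (c : Fin M → X) (x : X) :
    (codeDist c x).toReal = 1 / (M : ℝ) * ∑ m, if c m = x then 1 else 0 := by
  simp only [codeDist, PMF.map_apply, PMF.uniformOfFintype_apply, Fintype.card_fin, tsum_fintype]
  rw [ENNReal.toReal_sum (fun m _ => by split_ifs <;> simp [NeZero.ne M]), Finset.mul_sum]
  refine Finset.sum_congr rfl fun m _ => ?_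
  by_cases h : c m = x
  · simp [h]
  · simp [h, Ne.symm h]

theorem trMul_cqState_codeDist {M : ℕ} [NeZero M] (c : Fin M → X) (W : X → Matrix n n ℂ)
    (T : Matrix (X × n) (X × n) ℂ) :
    trMul (cqState (codeDist c) W) T =
      1 / (M : ℂ) * ∑ m, (W (c m) * block T (c m)).trace := by
  have hsum : HasSum (fun a : X × n => ((codeDist c a.1).toReal : ℂ) *
      (W a.1 * block T a.1) a.2 a.2)
      (1 / (M : ℂ) * ∑ m, (W (c m) * block T (c m)).trace) := by
    have hm : ∀ m ∈ Finset.univ, HasSum (fun a : X × n => if c m = a.1 then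
        (W a.1 * block T a.1) a.2 a.2 else 0) (W (c m) * block T (c m)).trace := by
      intro m _
      have h := hasSum_sum_of_ne_finset_zero (L := .unconditional _)
        (f := fun a : X × n => if c m = a.1 then (W a.1 * block T a.1) a.2 a.2 else 0)
        (s := Finset.univ.map ⟨Prod.mk (c m), Prod.mk_right_injective (c m)⟩)
        (by
          rintro ⟨y, j⟩ hb
          exact if_neg fun h : c m = y => hb (by simp [h]))
      simpa [Matrix.trace] using h
    have hfun : (fun a : X × n => ((codeDist c a.1).toReal : ℂ) *
        (W a.1 * block T a.1) a.2 a.2) = fun a => 1 / (M : ℂ) * ∑ m, if c m = a.1 then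
          (W a.1 * block T a.1) a.2 a.2 else 0 := by
      funext a
      rw [codeDist_toReal]
      push_cast
      simp only [mul_assoc, Finset.sum_mul, apply_ite Complex.ofReal, Complex.ofReal_one,
        Complex.ofReal_zero, ite_mul, one_mul, zero_mul]
    rw [hfun]
    exact (hasSum_sum hm).mul_left _
  rw [trMul_cqState, hsum.tsum_eq]

omit [Fintype n] in
theorem IsTest.block [DecidableEq n] {T : Matrix (X × n) (X × n) ℂ} (hT : IsTest T) (x : X) :
    IsTest (block T x) := by
  refine ⟨hT.1.submatrix _, ?_⟩
  have h := hT.2.submatrix (Prod.mk x)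
  rwa [Matrix.submatrix_sub, Pi.sub_apply, Pi.sub_apply,
    Matrix.submatrix_one _ (Prod.mk_right_injective x)] at h

/-- Any family of tests on `ℂⁿ` is the family of diagonal blocks of a test on `ℓ²(X) ⊗ ℂⁿ`. -/
theorem exists_isTest_block_eq [DecidableEq n] {F : X → Matrix n n ℂ} (hF : ∀ x, IsTest (F x)) :
    ∃ T : Matrix (X × n) (X × n) ℂ, IsTest T ∧ ∀ x, block T x = F x := by
  refine ⟨(Matrix.blockDiagonal F).submatrix Prod.swap Prod.swap, ⟨?_, ?_⟩, fun x => ?_⟩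
  · exact (posSemidef_blockDiagonal fun x => (hF x).1).submatrix _
  · have h := (posSemidef_blockDiagonal fun x => (hF x).2).submatrix (Prod.swap : X × n → n × X)
    have h1 : (Matrix.blockDiagonal fun x => 1 - F x) = 1 - Matrix.blockDiagonal F := by
      rw [← Matrix.blockDiagonal_one, ← Matrix.blockDiagonal_sub]
      rfl
    rwa [h1, Matrix.submatrix_sub, Pi.sub_apply, Pi.sub_apply,
      Matrix.submatrix_one _ Prod.swap_injective] at h
  · ext i j
    simp [CQ.block, Matrix.blockDiagonal_apply]

theorem typeIError_cqState_nonneg [DecidableEq n] (P : PMF X) {W : X → Matrix n n ℂ}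
    (hW : ∀ x, IsDensityMatrix (W x)) {T : Matrix (X × n) (X × n) ℂ} (hT : IsTest T) :
    0 ≤ typeIError (cqState P W) T := by
  rw [typeIError, sub_nonneg, trMul_cqState]
  by_cases hs : Summable fun a : X × n => ((P a.1).toReal : ℂ) * (W a.1 * block T a.1) a.2 a.2
  · have hP : HasSum (fun x => (P x).toReal) 1 := by
      have h := ENNReal.hasSum_toReal (f := P) (by simp [P.tsum_coe])
      rwa [← ENNReal.tsum_toReal_eq P.apply_ne_top, P.tsum_coe, ENNReal.toReal_one] at h
    have hx := hs.hasSum.prod_fiberwise fun x => hasSum_fintype _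
    refine hasSum_le (fun x => ?_) (Complex.hasSum_re hx) hP
    have h := (Complex.le_def.mp (trace_mul_le_trace (hW x).1 (hT.block x).2)).1
    rw [(hW x).2, Complex.one_re] at h
    change (∑ i, ((P x).toReal : ℂ) * (W x * block T x) i i).re ≤ _
    rw [← Finset.mul_sum, Complex.re_ofReal_mul]
    exact mul_le_of_le_one_right ENNReal.toReal_nonneg h
  · -- Convergence need not be proved: a divergent sum has the value `0`, which is at most `1`.
    rw [tsum_eq_zero_of_not_summable hs]
    simp

theorem zero_mem_lowerBounds_typeIError [DecidableEq n] (P : PMF X) {W : X → Matrix n n ℂ}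
    (hW : ∀ x, IsDensityMatrix (W x)) (S : Matrix (X × n) (X × n) ℂ) (β : ℝ) :
    0 ∈ lowerBounds (typeIError (cqState P W) '' {T | IsTest T ∧ typeIIError S T ≤ β}) := by
  rintro _ ⟨T, hT, rfl⟩
  exact typeIError_cqState_nonneg P hW hT.1

theorem alpha_cqState_nonneg [DecidableEq n] (P : PMF X) {W : X → Matrix n n ℂ}
    (hW : ∀ x, IsDensityMatrix (W x)) (S : Matrix (X × n) (X × n) ℂ) (β : ℝ) :
    0 ≤ alpha β (cqState P W) S :=
  Real.sInf_nonneg (zero_mem_lowerBounds_typeIError P hW S β)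

end States

/-! ### Decoders against binary tests -/

section MetaConverse

variable {X n : Type*} [DecidableEq X] [Fintype n] [DecidableEq n] {M : ℕ}

omit [DecidableEq n] in
theorem typeIError_codeDist [NeZero M] (c : Fin M → X) (W : X → Matrix n n ℂ)
    (T : Matrix (X × n) (X × n) ℂ) :
    typeIError (cqState (codeDist c) W) T =
      1 - 1 / (M : ℝ) * ∑ m, (W (c m) * block T (c m)).trace.re := by
  have h : (1 / (M : ℂ)) = ((1 / (M : ℝ) : ℝ) : ℂ) := by push_cast; rfl
  rw [typeIError, trMul_cqState_codeDist, h, Complex.re_ofReal_mul, Complex.re_sum]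

omit [DecidableEq n] in
theorem typeIIError_codeDist [NeZero M] (c : Fin M → X) (μ : Matrix n n ℂ)
    (T : Matrix (X × n) (X × n) ℂ) :
    typeIIError (prodState (codeDist c) μ) T =
      1 / (M : ℝ) * ∑ m, (μ * block T (c m)).trace.re := by
  have h : (1 / (M : ℂ)) = ((1 / (M : ℝ) : ℝ) : ℂ) := by push_cast; rfl
  rw [typeIIError, prodState_eq_cqState, trMul_cqState_codeDist, h, Complex.re_ofReal_mul,
    Complex.re_sum]

/-- The test `T_x` for the input `x`: the average of the POVM elements `D m` over the messages `m`
encoded as `x`. If there are none, the inverse of `0` makes it the zero matrix. -/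
noncomputable def decoderTest (c : Fin M → X) (D : Fin M → Matrix n n ℂ) (x : X) : Matrix n n ℂ :=
  ((Finset.card {m | c m = x} : ℝ)⁻¹) • ∑ m with c m = x, D m

omit [Fintype n] in
theorem isTest_decoderTest (c : Fin M → X) {D : Fin M → Matrix n n ℂ} (hD : IsPOVM D) (x : X) :
    IsTest (decoderTest c D x) := by
  set N : ℝ := (Finset.card {m | c m = x} : ℝ)
  set S := ∑ m with c m = x, D m
  have hN : 0 ≤ N⁻¹ := by positivity
  have hN' : 0 ≤ 1 - N⁻¹ := sub_nonneg.mpr (Nat.cast_inv_le_one _)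
  refine ⟨(Matrix.posSemidef_sum _ fun m _ => hD.1 m).smul hN, ?_⟩
  have h : 1 - N⁻¹ • S = N⁻¹ • (1 - S) + (1 - N⁻¹) • (1 : Matrix n n ℂ) := by module
  change (1 - N⁻¹ • S).PosSemidef
  rw [h]
  exact ((hD.posSemidef_one_sub_sum _).smul hN).add (Matrix.PosSemidef.one.smul hN')

omit [DecidableEq n] in
/-- Averaging the POVM elements of the messages that share a codeword does not change the success
probability, since these messages give the same output state. -/
theorem sum_trace_mul_decoderTest (c : Fin M → X) (D : Fin M → Matrix n n ℂ)
    (W : X → Matrix n n ℂ) :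
    ∑ m, (W (c m) * decoderTest c D (c m)).trace.re = ∑ m, (W (c m) * D m).trace.re := by
  have h1 : ∀ m, (W (c m) * decoderTest c D (c m)).trace.re =
      ∑ k, if c k = c m then
        (Finset.card {l | c l = c k} : ℝ)⁻¹ * (W (c k) * D k).trace.re else 0 := by
    intro m
    rw [decoderTest, Matrix.mul_smul, Matrix.trace_smul, Complex.smul_re, Matrix.mul_sum,
      Matrix.trace_sum, Complex.re_sum, smul_eq_mul, Finset.mul_sum, Finset.sum_filter]
    refine Finset.sum_congr rfl fun k _ => ?_
    split_ifs with h
    · rw [h]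
    · rfl
  rw [Finset.sum_congr rfl fun m _ => h1 m, Finset.sum_comm]
  refine Finset.sum_congr rfl fun k _ => ?_
  have hpos : (Finset.card {l | c l = c k} : ℝ) ≠ 0 := by
    have : k ∈ ({l | c l = c k} : Finset (Fin M)) := by simp
    exact_mod_cast (Finset.card_pos.mpr ⟨k, this⟩).ne'
  simp only [eq_comm (a := c k)]
  rw [← Finset.sum_filter, Finset.sum_const, nsmul_eq_mul, mul_inv_cancel_left₀ hpos]

/-- Every decoder gives a test between `P_𝒞 W` and `P_𝒞 ⊗ μ` whose first error is the error of the
decoder. Its second error is exactly `1 / M`: under `μ` the decoder guesses. -/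
theorem exists_isTest_of_isPOVM [NeZero M] (W : X → Matrix n n ℂ) (c : Fin M → X)
    {D : Fin M → Matrix n n ℂ} (hD : IsPOVM D) {μ : Matrix n n ℂ} (hμ : IsDensityMatrix μ) :
    ∃ T, (IsTest T ∧ typeIIError (prodState (codeDist c) μ) T ≤ 1 / (M : ℝ)) ∧
      typeIError (cqState (codeDist c) W) T = codeError W c D := by
  obtain ⟨T, hT, hblock⟩ := exists_isTest_block_eq (isTest_decoderTest c hD)
  refine ⟨T, ⟨hT, ?_⟩, ?_⟩
  · simp only [typeIIError_codeDist, hblock]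
    rw [sum_trace_mul_decoderTest c D fun _ => μ, ← Complex.re_sum, ← Matrix.trace_sum,
      ← Matrix.mul_sum, hD.2, Matrix.mul_one, hμ.2, Complex.one_re, mul_one]
  · simp only [typeIError_codeDist, hblock, sum_trace_mul_decoderTest, codeError]

theorem alpha_le_Pe [NeZero M] {W : X → Matrix n n ℂ} (hW : ∀ x, IsDensityMatrix (W x))
    (c : Fin M → X) {μ : Matrix n n ℂ} (hμ : IsDensityMatrix μ) :
    alpha (1 / (M : ℝ)) (cqState (codeDist c) W) (prodState (codeDist c) μ) ≤ Pe W c := by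
  obtain ⟨D, hD, hPe⟩ := (isLeast_Pe W c).1
  obtain ⟨T, hT, hTe⟩ := exists_isTest_of_isPOVM W c hD hμ
  rw [← hPe, ← hTe]
  exact csInf_le ⟨0, zero_mem_lowerBounds_typeIError _ hW _ _⟩ ⟨T, hT, rfl⟩

/-- The maximizing `μ` is the dual solution `K`, normalized to unit trace. Since `K` dominates each
`W (c m)`, a test whose second error under `μ` is at most `1 / M` succeeds with probability at most
`tr K / M = 1 - Pe`. -/
theorem exists_Pe_le_alpha [NeZero M] {W : X → Matrix n n ℂ} (hW : ∀ x, IsDensityMatrix (W x))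
    (c : Fin M → X) :
    ∃ μ : DensityMatrix n, Pe W c ≤
      alpha (1 / (M : ℝ)) (cqState (codeDist c) W) (prodState (codeDist c) μ) := by
  obtain ⟨D, hD, hPe⟩ := (isLeast_Pe W c).1
  have hM : (0 : ℝ) < M := Nat.cast_pos.mpr (NeZero.pos M)
  have hopt : ∀ D' : Fin M → Matrix n n ℂ, IsPOVM D' →
      ∑ m, (W (c m) * D' m).trace.re ≤ ∑ m, (W (c m) * D m).trace.re := by
    intro D' hD'
    have h := (isLeast_Pe W c).2 ⟨D', hD', rfl⟩
    rw [← hPe, codeError, codeError, sub_le_sub_iff_left] at h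
    exact le_of_mul_le_mul_left h (by positivity)
  obtain ⟨K, hK, hKtr⟩ :=
    exists_trace_eq_of_optimal (fun m => (hW (c m)).1.isHermitian) hD hopt
  have hKpos : K.PosSemidef := by
    simpa using (hK 0).add (hW (c 0)).1
  have hKre : K.trace = (K.trace.re : ℂ) :=
    Complex.eq_re_of_ofReal_le (r := 0) (by simpa using hKpos.trace_nonneg)
  have ht : 0 < K.trace.re := by
    have h := (Complex.le_def.mp (hK 0).trace_nonneg).1
    rw [Matrix.trace_sub, (hW (c 0)).2, Complex.zero_re, Complex.sub_re, Complex.one_re] at h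
    linarith
  have hμ : IsDensityMatrix (K.trace.re⁻¹ • K) := by
    refine ⟨hKpos.smul (inv_nonneg.mpr ht.le), ?_⟩
    rw [Matrix.trace_smul, ← Complex.coe_smul, smul_eq_mul, Complex.ofReal_inv, ← hKre]
    exact inv_mul_cancel₀ fun h => ht.ne' (by rw [h, Complex.zero_re])
  refine ⟨⟨_, hμ⟩, le_csInf ?_ ?_⟩
  · obtain ⟨T, hT, -⟩ := exists_isTest_of_isPOVM W c hD hμ
    exact ⟨_, T, hT, rfl⟩
  · rintro _ ⟨T, ⟨hT, hβ⟩, rfl⟩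
    rw [typeIIError_codeDist] at hβ
    have hβ' : ∑ m, (K * block T (c m)).trace.re ≤ K.trace.re := by
      simp only [Matrix.smul_mul, Matrix.trace_smul, Complex.smul_re, smul_eq_mul,
        ← Finset.mul_sum] at hβ
      have h := le_of_mul_le_mul_left (hβ.trans_eq (mul_one _).symm) (by positivity)
      rwa [inv_mul_le_iff₀ ht, mul_one] at h
    rw [← hPe, codeError, typeIError_codeDist, ← hKtr]
    gcongr
    refine le_trans (Finset.sum_le_sum fun m _ => ?_) hβ'
    exact (Complex.le_def.mp (trace_mul_mono (hK m) (hT.block (c m)).1)).1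

end MetaConverse

end CQ

/-- Meta-converse: for a code of size `M ≥ 1` the minimum error probability (which is attained) is
the supremum over `μ` of `α_{1/M}(P_𝒞 W ‖ P_𝒞 ⊗ μ)`, and it is at least
`inf_P sup_μ α_{1/M}(P W ‖ P ⊗ μ)`. -/
theorem theorem2 {X n : Type*} [DecidableEq X] [Fintype n] [DecidableEq n]
    (W : X → Matrix n n ℂ) (hW : ∀ x, CQ.IsDensityMatrix (W x))
    (M : ℕ) [NeZero M] (c : Fin M → X) :
    IsLeast (CQ.codeError W c '' {D | CQ.IsPOVM D}) (CQ.Pe W c) ∧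
    IsLUB (Set.range fun μ : CQ.DensityMatrix n =>
        CQ.alpha (1 / (M : ℝ)) (CQ.cqState (CQ.codeDist c) W)
          (CQ.prodState (CQ.codeDist c) (μ : Matrix n n ℂ))) (CQ.Pe W c) ∧
    CQ.Pe W c = ⨆ μ : CQ.DensityMatrix n,
        CQ.alpha (1 / (M : ℝ)) (CQ.cqState (CQ.codeDist c) W)
          (CQ.prodState (CQ.codeDist c) (μ : Matrix n n ℂ)) ∧
    CQ.Pe W c ≥ ⨅ P : PMF X, ⨆ μ : CQ.DensityMatrix n,
        CQ.alpha (1 / (M : ℝ)) (CQ.cqState P W)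
          (CQ.prodState P (μ : Matrix n n ℂ)) := by
  obtain ⟨μ, hμ⟩ := CQ.exists_Pe_le_alpha hW c
  have hlub : IsGreatest (Set.range fun μ : CQ.DensityMatrix n =>
      CQ.alpha (1 / (M : ℝ)) (CQ.cqState (CQ.codeDist c) W)
        (CQ.prodState (CQ.codeDist c) (μ : Matrix n n ℂ))) (CQ.Pe W c) := by
    refine ⟨⟨μ, (CQ.alpha_le_Pe hW c μ.2).antisymm hμ⟩, ?_⟩
    rintro _ ⟨ν, rfl⟩
    exact CQ.alpha_le_Pe hW c ν.2
  have hsup := hlub.csSup_eq.symm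
  refine ⟨CQ.isLeast_Pe W c, hlub.isLUB, hsup, ?_⟩
  rw [ge_iff_le, hsup]
  refine ciInf_le (f := fun P : PMF X => ⨆ μ : CQ.DensityMatrix n,
    CQ.alpha (1 / (M : ℝ)) (CQ.cqState P W) (CQ.prodState P (μ : Matrix n n ℂ)))
    ⟨0, ?_⟩ (CQ.codeDist c)
  rintro _ ⟨P, rfl⟩
  exact Real.iSup_nonneg fun ν => CQ.alpha_cqState_nonneg P hW _ _
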